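/- Let $G$ be a finitely presented group, $\epsilon\colon G\to\langle t\mid\ \rangle\cong\mathbb Z$ an epimorphism with kernel $K$, $x\in G$ an element with $\epsilon(x)=t$, and $\mu$ the automorphism $u\mapsto xux^{-1}$ of $K$. Let $S_N$ act on $\{1,\dots,N\}$ from the right, and let $\rho\colon K\to S_N$ be a homomorphism with period $r\ge 1$, i.e. $\rho\circ\mu^r=\rho$ ($r$ need not be the least period). The Crowell group $K_\rho$ is the group with generators ${}^iu$ ($1\le i\le N$, $u\in K$) and relations ${}^i(uv)={}^iu\cdot{}^{i\rho(u)}v$. Its abelianization $K_\rho^{\rm ab}$ is a $\mathbb Z[s^{\pm1}]$-module with $s\cdot{}^iu={}^i(\mu^r(u))$. The Alexander–Lin polynomial $D_{\rho,r}(s)\in\mathbb Z[s^{\pm1}]$ is the order of this module, i.e. the greatest common divisor of the maximal minors of a finite presentation matrix (of size columns $\times$ columns, where the columns correspond to generators and the rows to relations), defined up to units of $\mathbb Z[s^{\pm1}]$. For an endomorphism $h$ of a group $H$ with finite generating family $g_1,\dots,g_n$, the growth rate is ${\rm GR}(h)=\max_i\limsup_{k\to\infty}\|h^k(g_i)\|^{1/k}$,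 where $\|\cdot\|$ is the word length with respect to $g_1,\dots,g_n$ (and ${\rm GR}(h)=0$ if $n=0$). Theorem. If $K$ is finitely generated, then $D_{\rho,r}$ exists and is nonzero, and every zero $z\in\mathbb C\setminus\{0\}$ of $D_{\rho,r}$ satisfies $$|z|^{1/r}\le {\rm GR}(\mu),$$ where ${\rm GR}(\mu)$ may be computed with any finite generating family of $K$. -/

import Mathlib

open scoped LaurentPolynomial

/-! ### Augmented group systems and the representation shift -/

/-- An augmented group system: a finitely presented group `G`, an epimorphism `ε` onto the
infinite cyclic group, written as `Multiplicative ℤ` with generator `t = Multiplicative.ofAdd 1`,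
and an element `x` with `ε x = t`. -/
structure AugmentedGroupSystem (G : Type*) [Group G] where
  finitelyPresented : Group.IsFinitelyPresented G
  ε : G →* Multiplicative ℤ
  surjective : Function.Surjective ε
  x : G
  ε_x : ε x = Multiplicative.ofAdd 1

/-- The symmetric group on `N` symbols, with permutations multiplied from left to right, so that
it acts on the symbols from the right. -/
abbrev SymGroup (N : ℕ) : Type := (Equiv.Perm (Fin N))ᵐᵒᵖ

/-- The image `i π` of the symbol `i` under the permutation `π`. -/
def SymGroup.act {N : ℕ} (i : Fin N) (π : SymGroup N) : Fin N := π.unop i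

namespace AugmentedGroupSystem

variable {G : Type*} [Group G] (S : AugmentedGroupSystem G) {N : ℕ}

/-- The kernel `K` of `ε`. -/
abbrev K : Subgroup G := S.ε.ker

/-- The automorphism `u ↦ x u x⁻¹` of `K`. -/
def μ : MulAut S.K := MulAut.conjNormal S.x

theorem coe_μ (u : S.K) : ((S.μ u : S.K) : G) = S.x * u * S.x⁻¹ := rfl

/-- The shift `σ ρ = ρ ∘ μ` on representations `K → S_N`. -/
def shift (ρ : S.K →* SymGroup N) : S.K →* SymGroup N := ρ.comp S.μ.toMonoidHom

/-- `ρ` has period `r`, i.e. `σ ^ r ρ = ρ`. The number `r` need not be the least period. -/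
def IsPeriodic (ρ : S.K →* SymGroup N) (r : ℕ) : Prop := S.shift^[r] ρ = ρ

theorem shift_iterate_apply (ρ : S.K →* SymGroup N) (r : ℕ) (u : S.K) :
    (S.shift^[r] ρ) u = ρ ((S.μ ^ r) u) := by
  induction r generalizing u with
  | zero => rfl
  | succ r ih =>
    rw [Function.iterate_succ_apply', pow_succ]
    exact ih _

end AugmentedGroupSystem

/-! ### The Crowell group -/

section Crowell

variable {K : Type*} [Group K] {N : ℕ}

/-- The relators `ⁱ(uv) (ⁱu · ^{iρ(u)}v)⁻¹` on the generators `ⁱu = (i, u)`. -/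
def crowellRels (ρ : K →* SymGroup N) : Set (FreeGroup (Fin N × K)) :=
  {w | ∃ (i : Fin N) (u v : K), w = FreeGroup.of (i, u * v) *
    (FreeGroup.of (i, u) * FreeGroup.of (SymGroup.act i (ρ u), v))⁻¹}

/-- The Crowell group `K_ρ`. -/
abbrev CrowellGroup (ρ : K →* SymGroup N) : Type _ := PresentedGroup (crowellRels ρ)

namespace CrowellGroup

/-- The generator `ⁱu`. -/
def gen (ρ : K →* SymGroup N) (i : Fin N) (u : K) : CrowellGroup ρ := PresentedGroup.of (i, u)

theorem gen_mul (ρ : K →* SymGroup N) (i : Fin N) (u v : K) :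
    gen ρ i (u * v) = gen ρ i u * gen ρ (SymGroup.act i (ρ u)) v := by
  have h : PresentedGroup.mk (crowellRels ρ) (FreeGroup.of (i, u * v) *
      (FreeGroup.of (i, u) * FreeGroup.of (SymGroup.act i (ρ u), v))⁻¹) = 1 :=
    PresentedGroup.one_of_mem ⟨i, u, v, rfl⟩
  rw [map_mul, map_inv, mul_inv_eq_one, map_mul] at h
  exact h

/-- The endomorphism `ⁱu ↦ ⁱα(u)` of `K_ρ`, for an automorphism `α` of `K` with `ρ ∘ α = ρ`. -/
def mapHom (ρ : K →* SymGroup N) (α : MulAut K) (h : ∀ u, ρ (α u) = ρ u) :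
    CrowellGroup ρ →* CrowellGroup ρ :=
  PresentedGroup.toGroup (f := fun p : Fin N × K => gen ρ p.1 (α p.2)) <| by
    rintro _ ⟨i, u, v, rfl⟩
    simp [gen_mul, h]

theorem mapHom_gen (ρ : K →* SymGroup N) (α : MulAut K) (h : ∀ u, ρ (α u) = ρ u)
    (i : Fin N) (u : K) : mapHom ρ α h (gen ρ i u) = gen ρ i (α u) :=
  PresentedGroup.toGroup.of _

/-- The automorphism `ⁱu ↦ ⁱα(u)` of `K_ρ`, for an automorphism `α` of `K` with `ρ ∘ α = ρ`. -/
def mapEquiv (ρ : K →* SymGroup N) (α : MulAut K) (h : ∀ u, ρ (α u) = ρ u) :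
    CrowellGroup ρ ≃* CrowellGroup ρ :=
  have h' : ∀ u, ρ (α⁻¹ u) = ρ u := fun u => by rw [← h (α⁻¹ u), MulAut.apply_inv_self]
  MonoidHom.toMulEquiv (mapHom ρ α h) (mapHom ρ α⁻¹ h')
    (PresentedGroup.ext fun p => by
      change mapHom ρ α⁻¹ h' (mapHom ρ α h (gen ρ p.1 p.2)) = gen ρ p.1 p.2
      rw [mapHom_gen, mapHom_gen, MulAut.inv_apply_self])
    (PresentedGroup.ext fun p => by
      change mapHom ρ α h (mapHom ρ α⁻¹ h' (gen ρ p.1 p.2)) = gen ρ p.1 p.2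
      rw [mapHom_gen, mapHom_gen, MulAut.apply_inv_self])

end CrowellGroup

end Crowell

/-! ### The twisted Alexander module -/

/-- The action of `ℤ[s, s⁻¹]` on an abelian group `M` in which `s` acts by the automorphism `f`. -/
noncomputable def laurentAction {M : Type*} [AddCommGroup M] (f : M ≃+ M) :
    ℤ[T;T⁻¹] →ₐ[ℤ] Module.End ℤ M :=
  AddMonoidAlgebra.lift ℤ (Module.End ℤ M) ℤ
    ((Units.coeHom (Module.End ℤ M)).comp
      (zpowersHom (Module.End ℤ M)ˣ
        (LinearMap.GeneralLinearGroup.ofLinearEquiv f.toIntLinearEquiv)))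

theorem laurentAction_T {M : Type*} [AddCommGroup M] (f : M ≃+ M) (m : M) :
    laurentAction f (LaurentPolynomial.T 1) m = f m := by
  have h : laurentAction f (LaurentPolynomial.T 1) =
      (1 : ℤ) • ((((LinearMap.GeneralLinearGroup.ofLinearEquiv f.toIntLinearEquiv) ^ (1 : ℤ) :
        (Module.End ℤ M)ˣ)) : Module.End ℤ M) :=
    AddMonoidAlgebra.lift_single _ _ _
  rw [h, one_smul, zpow_one]
  rfl

namespace AugmentedGroupSystem

variable {G : Type*} [Group G] (S : AugmentedGroupSystem G) {N : ℕ}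

/-- The automorphism `ⁱu ↦ ⁱ(μ ^ r u)` of `K_ρ`, for `ρ` of period `r`. -/
def crowellAut (ρ : S.K →* SymGroup N) (r : ℕ) (hρ : S.IsPeriodic ρ r) :
    CrowellGroup ρ ≃* CrowellGroup ρ :=
  CrowellGroup.mapEquiv ρ (S.μ ^ r) fun u => by
    rw [← S.shift_iterate_apply]
    exact DFunLike.congr_fun hρ u

/-- The abelianization `K_ρ^ab`, as a module over `ℤ[s, s⁻¹]`; see the instance below. -/
def AlexanderModule (ρ : S.K →* SymGroup N) (r : ℕ) (_hρ : S.IsPeriodic ρ r) : Type _ :=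
  Additive (Abelianization (CrowellGroup ρ))

instance (ρ : S.K →* SymGroup N) (r : ℕ) (hρ : S.IsPeriodic ρ r) :
    AddCommGroup (S.AlexanderModule ρ r hρ) :=
  inferInstanceAs (AddCommGroup (Additive (Abelianization (CrowellGroup ρ))))

/-- The class of the generator `ⁱu` in `K_ρ^ab`. -/
def alexanderGen (ρ : S.K →* SymGroup N) (r : ℕ) (hρ : S.IsPeriodic ρ r) (i : Fin N) (u : S.K) :
    S.AlexanderModule ρ r hρ :=
  Additive.ofMul (Abelianization.of (CrowellGroup.gen ρ i u))

/-- The automorphism of `K_ρ^ab` induced by `ⁱu ↦ ⁱ(μ ^ r u)`. -/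
def alexanderAut (ρ : S.K →* SymGroup N) (r : ℕ) (hρ : S.IsPeriodic ρ r) :
    S.AlexanderModule ρ r hρ ≃+ S.AlexanderModule ρ r hρ :=
  MulEquiv.toAdditive (S.crowellAut ρ r hρ).abelianizationCongr

/-- The module structure of `K_ρ^ab` with `s ⁱu = ⁱ(μ ^ r u)`. -/
noncomputable instance (ρ : S.K →* SymGroup N) (r : ℕ) (hρ : S.IsPeriodic ρ r) :
    Module ℤ[T;T⁻¹] (S.AlexanderModule ρ r hρ) :=
  Module.compHom (S.AlexanderModule ρ r hρ)
    (laurentAction (S.alexanderAut ρ r hρ)).toRingHom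

theorem T_smul_alexanderGen (ρ : S.K →* SymGroup N) (r : ℕ) (hρ : S.IsPeriodic ρ r)
    (i : Fin N) (u : S.K) :
    (LaurentPolynomial.T 1 : ℤ[T;T⁻¹]) • S.alexanderGen ρ r hρ i u =
      S.alexanderGen ρ r hρ i ((S.μ ^ r) u) := by
  change laurentAction (S.alexanderAut ρ r hρ) (LaurentPolynomial.T 1) _ = _
  rw [laurentAction_T]
  exact congrArg (fun y => Additive.ofMul (Abelianization.of y))
    (CrowellGroup.mapHom_gen ρ (S.μ ^ r) (fun u => by
      rw [← S.shift_iterate_apply]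
      exact DFunLike.congr_fun hρ u) i u)

end AugmentedGroupSystem

/-! ### The order of a module -/

/-- The `p × n` matrix `A` presents the `R`-module `M`: its columns correspond to generators of
`M` and its rows to relations. -/
def IsPresentationMatrix {R : Type*} [CommRing R] {p n : ℕ} (A : Matrix (Fin p) (Fin n) R)
    (M : Type*) [AddCommGroup M] [Module R M] : Prop :=
  Nonempty (((Fin n → R) ⧸ Submodule.span R (Set.range fun i => A i)) ≃ₗ[R] M)

/-- `D` is an order `Δ₀ M` of `M`: a greatest common divisor of the maximal minors (the `n × n`
minors, `n` being the number of columns) of a finite presentation matrix of `M`. If `e` below is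
not injective, the determinant vanishes and does not affect the greatest common divisor;
in particular `D = 0` if there are fewer rows than columns. -/
def IsOrder {R : Type*} [CommRing R] (M : Type*) [AddCommGroup M] [Module R M] (D : R) : Prop :=
  ∃ (p n : ℕ) (A : Matrix (Fin p) (Fin n) R), IsPresentationMatrix A M ∧
    ∀ d : R, d ∣ D ↔ ∀ e : Fin n → Fin p, d ∣ (A.submatrix e id).det

/-- `D` is an Alexander-Lin polynomial `D_{ρ,r}` of the representation `ρ` of period `r`: an order
of the `ℤ[s, s⁻¹]`-module `K_ρ^ab`. It is determined up to multiplication by units. -/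
def AugmentedGroupSystem.IsAlexanderLin {G : Type*} [Group G] (S : AugmentedGroupSystem G) {N : ℕ}
    (ρ : S.K →* SymGroup N) (r : ℕ) (hρ : S.IsPeriodic ρ r) (D : ℤ[T;T⁻¹]) : Prop :=
  IsOrder (S.AlexanderModule ρ r hρ) D

/-! ### Growth rates -/

section Growth

variable {H : Type*} [Group H] {n : ℕ}

/-- The word length of `u` with respect to the generators `g₁, …, gₙ`: the minimal length of a
word in the `gᵢ` and their inverses that describes `u`. -/
noncomputable def wordLength (g : Fin n → H) (u : H) : ℕ :=
  sInf {m | ∃ w : List (Fin n × Bool), w.length = m ∧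
    (w.map fun p => if p.2 then g p.1 else (g p.1)⁻¹).prod = u}

/-- The growth rate `max_i limsup_k ‖h ^ k (gᵢ)‖ ^ (1 / k)` of the endomorphism `h`, computed with
the generators `g₁, …, gₙ`. -/
noncomputable def growthRate (g : Fin n → H) (h : H →* H) : ENNReal :=
  ⨆ i : Fin n, Filter.limsup
    (fun k : ℕ => (wordLength g (h^[k] (g i)) : ENNReal) ^ (1 / (k : ℝ))) Filter.atTop

theorem exists_word (g : Fin n → H) (hg : Subgroup.closure (Set.range g) = ⊤) (u : H) :
    ∃ w : List (Fin n × Bool), w.length = wordLength g u ∧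
      (w.map fun p => if p.2 then g p.1 else (g p.1)⁻¹).prod = u := by
  have key : ∃ w : List (Fin n × Bool),
      (w.map fun p => if p.2 then g p.1 else (g p.1)⁻¹).prod = u := by
    have hu : u ∈ Subgroup.closure (Set.range g) := hg ▸ Subgroup.mem_top u
    rw [← FreeGroup.range_lift_eq_closure] at hu
    obtain ⟨w, rfl⟩ := hu
    refine ⟨w.toWord, ?_⟩
    conv_rhs => rw [← FreeGroup.mk_toWord (x := w), FreeGroup.lift_mk]
    congr 2
    funext p
    cases p.2 <;> rfl
  obtain ⟨w, hw⟩ := key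
  exact Nat.sInf_mem (s := {m | ∃ w : List (Fin n × Bool), w.length = m ∧
    (w.map fun p => if p.2 then g p.1 else (g p.1)⁻¹).prod = u}) ⟨_, w, rfl, hw⟩

theorem wordLength_le (g : Fin n → H) (w : List (Fin n × Bool)) :
    wordLength g ((w.map fun p => if p.2 then g p.1 else (g p.1)⁻¹).prod) ≤ w.length :=
  Nat.sInf_le ⟨w, rfl, rfl⟩

theorem wordLength_mul_le (g : Fin n → H) (hg : Subgroup.closure (Set.range g) = ⊤) (u v : H) :
    wordLength g (u * v) ≤ wordLength g u + wordLength g v := by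
  obtain ⟨w, hw, rfl⟩ := exists_word g hg u
  obtain ⟨w', hw', rfl⟩ := exists_word g hg v
  rw [← hw, ← hw', ← List.length_append, ← List.prod_append, ← List.map_append]
  exact wordLength_le g _

theorem wordLength_inv_le (g : Fin n → H) (hg : Subgroup.closure (Set.range g) = ⊤) (u : H) :
    wordLength g u⁻¹ ≤ wordLength g u := by
  obtain ⟨w, hw, rfl⟩ := exists_word g hg u
  rw [← hw]
  refine Nat.sInf_le ⟨(w.map fun p => (p.1, !p.2)).reverse, by simp, ?_⟩
  rw [List.prod_inv_reverse, List.map_reverse, List.map_map, List.map_map]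
  congr 2
  refine List.map_congr_left fun p _ => ?_
  rcases p with ⟨i, _ | _⟩ <;> simp

theorem wordLength_map_le (g : Fin n → H) (hg : Subgroup.closure (Set.range g) = ⊤) (h : H →* H)
    (u : H) : wordLength g (h u) ≤ (∑ i, wordLength g (h (g i))) * wordLength g u := by
  obtain ⟨w, hw, rfl⟩ := exists_word g hg u
  rw [← hw]
  clear hw
  induction w with
  | nil => simpa using wordLength_le g []
  | cons p w ih =>
    rw [List.map_cons, List.prod_cons, map_mul, List.length_cons, mul_add, mul_one, add_comm]
    refine (wordLength_mul_le g hg _ _).trans (add_le_add ?_ ih)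
    have hp : wordLength g (h (g p.1)) ≤ ∑ i, wordLength g (h (g i)) :=
      Finset.single_le_sum (f := fun i => wordLength g (h (g i))) (fun _ _ => Nat.zero_le _)
        (Finset.mem_univ p.1)
    split_ifs
    · exact hp
    · rw [map_inv]
      exact (wordLength_inv_le g hg _).trans hp

/-- Growth rates of endomorphisms of finitely generated groups are finite. -/
theorem growthRate_lt_top (g : Fin n → H) (hg : Subgroup.closure (Set.range g) = ⊤)
    (h : H →* H) : growthRate g h < ⊤ := by
  set C : ℕ := ∑ i, wordLength g (h (g i)) with hC
  refine lt_of_le_of_lt (iSup_le fun i => ?_) (ENNReal.natCast_lt_top C)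
  refine Filter.limsup_le_of_le (by isBoundedDefault) ?_
  filter_upwards [Filter.eventually_gt_atTop 0] with k hk
  have hb : wordLength g (h^[k] (g i)) ≤ C ^ k := by
    have hi : wordLength g (g i) ≤ 1 := by
      simpa using wordLength_le g [(i, true)]
    have hk' : wordLength g (h^[k] (g i)) ≤ C ^ k * wordLength g (g i) := by
      clear hk
      induction k with
      | zero => simp
      | succ k ih =>
        rw [Function.iterate_succ_apply', pow_succ', mul_assoc]
        exact (wordLength_map_le g hg h _).trans (Nat.mul_le_mul_left _ ih)
    exact hk'.trans (by simpa using Nat.mul_le_mul_left (C ^ k) hi)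
  calc (wordLength g (h^[k] (g i)) : ENNReal) ^ (1 / (k : ℝ))
      ≤ ((C ^ k : ℕ) : ENNReal) ^ (1 / (k : ℝ)) :=
        ENNReal.rpow_le_rpow (by exact_mod_cast hb) (by positivity)
    _ = C := by
        rw [Nat.cast_pow, ← ENNReal.rpow_natCast, ← ENNReal.rpow_mul,
          mul_one_div_cancel (by positivity), ENNReal.rpow_one]

end Growth

/-! A zero `z` of `D` is an eigenvalue of `s`: evaluation at `z` kills `D`, hence every maximal
minor of a presentation matrix, so the evaluated matrix has a nonzero kernel vector. Pairing with
that vector gives a nonzero additive `φ : K_ρ^ab → ℂ` with `φ (s m) = z φ m`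
(`IsOrder.exists_semilinear`).

The Crowell relation becomes `ⁱ(uv) = ⁱu + ^{iρ(u)}v`, so `ⁱu` splits along a word for `u` into
terms `± ᵃgⱼ`, one per letter. Hence `‖φ(ⁱu)‖ ≤ C · ‖u‖`, with `C` independent of `i` and `u`
(`norm_alexanderGen_le`). Choosing `φ(ⁱgⱼ) ≠ 0`, this gives `|z|^k ‖φ(ⁱgⱼ)‖ = ‖φ(ⁱ(μ^{rk} gⱼ))‖ ≤ C
‖μ^{rk} gⱼ‖`; take `rk`-th roots.

Existence of `D` is a gcd in a Noetherian UFD. If `D = 0`, every `z ≠ 0` would be a zero,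
contradicting `growthRate_lt_top`. -/

/-! ### Matrices all of whose maximal minors vanish -/

/-- A matrix over a field whose maximal minors all vanish has a nontrivial kernel. -/
theorem Matrix.exists_mulVec_eq_zero_of_minors {F : Type*} [Field F] {p n : ℕ}
    (A : Matrix (Fin p) (Fin n) F) (h : ∀ e : Fin n → Fin p, (A.submatrix e id).det = 0) :
    ∃ v : Fin n → F, v ≠ 0 ∧ A.mulVec v = 0 := by
  by_contra! hA
  have hinj : Function.Injective A.mulVec := by
    rw [← Matrix.coe_mulVecLin, injective_iff_map_eq_zero]
    intro v hv
    by_contra hne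
    exact hA v hne hv
  have hrank : A.rank = n := by
    rw [Matrix.rank, LinearMap.finrank_range_of_inj hinj, Module.finrank_fin_fun]
  -- Row rank equals column rank, so some `n` rows are independent; their minor cannot vanish.
  rw [Matrix.rank_eq_finrank_span_row] at hrank
  obtain ⟨b, hb, hspan, hli⟩ := exists_linearIndependent F (Set.range A.row)
  have hfin : Fintype b := ((Set.finite_range A.row).subset hb).fintype
  have hcard : Fintype.card b = n := by
    rw [← Set.toFinset_card, ← finrank_span_set_eq_card hli, hspan, hrank]
  let c : Fin n ≃ b := (finCongr hcard.symm).trans (Fintype.equivFin b).symm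
  choose e he using fun i => hb (c i).2
  have hrows : LinearIndependent F (A.submatrix e id).row := by
    have : (A.submatrix e id).row = (fun x : b => (x : Fin n → F)) ∘ c := by
      funext i
      exact he i
    rw [this]
    exact hli.comp c c.injective
  rw [Matrix.linearIndependent_rows_iff_isUnit, Matrix.isUnit_iff_isUnit_det, h e] at hrows
  exact not_isUnit_zero hrows

/-- If an order of a module is killed by a ring homomorphism `f` to a field, then the module has
a nonzero `f`-semilinear functional. -/
theorem IsOrder.exists_semilinear {R F : Type*} [CommRing R] [Field F] {M : Type*}
    [AddCommGroup M] [Module R M] {D : R} (hD : IsOrder M D) (f : R →+* F) (hf : f D = 0) :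
    ∃ φ : M →ₛₗ[f] F, φ ≠ 0 := by
  obtain ⟨p, n, A, ⟨E⟩, hgcd⟩ := hD
  obtain ⟨v, hv, hAv⟩ := (A.map f).exists_mulVec_eq_zero_of_minors fun e => by
    obtain ⟨c, hc⟩ := (hgcd D).1 dvd_rfl e
    rw [Matrix.submatrix_map, ← RingHom.mapMatrix_apply, ← RingHom.map_det, hc, map_mul, hf,
      zero_mul]
  -- Pairing with `v` kills each row of `A` because `A v = 0` after applying `f`, so it descends to
  -- the presented module.
  let ψ : (Fin n → R) →ₛₗ[f] F :=
    { toFun := fun w => ∑ j, f (w j) * v j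
      map_add' := fun a b => by simp [add_mul, Finset.sum_add_distrib]
      map_smul' := fun r a => by simp [Finset.mul_sum, mul_assoc] }
  have hψ : Submodule.span R (Set.range fun i => A i) ≤ LinearMap.ker ψ := by
    rw [Submodule.span_le]
    rintro _ ⟨i, rfl⟩
    exact congrFun hAv i
  refine ⟨(Submodule.liftQ _ ψ hψ).comp E.symm.toLinearMap, fun h0 => hv ?_⟩
  funext j
  have h1 := LinearMap.congr_fun h0 (E (Submodule.Quotient.mk (Pi.single j 1)))
  simpa [ψ, Pi.single_apply, apply_ite f] using h1

/-! ### Existence of orders -/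

theorem exists_isPresentationMatrix (R M : Type*) [CommRing R] [IsNoetherianRing R]
    [AddCommGroup M] [Module R M] [Module.Finite R M] :
    ∃ (p n : ℕ) (A : Matrix (Fin p) (Fin n) R), IsPresentationMatrix A M := by
  obtain ⟨n, f, hf⟩ := Module.Finite.exists_fin' R M
  obtain ⟨p, A, hA⟩ := Submodule.fg_iff_exists_fin_generating_family.1
    (IsNoetherian.noetherian (LinearMap.ker f))
  exact ⟨p, n, A, ⟨(Submodule.quotEquivOfEq _ _ hA).trans (f.quotKerEquivOfSurjective hf)⟩⟩

/-- Only finitely many minors occur, and a UFD has gcds of finite families. -/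
theorem exists_isOrder (R M : Type*) [CommRing R] [IsDomain R] [IsNoetherianRing R]
    [UniqueFactorizationMonoid R] [AddCommGroup M] [Module R M] [Module.Finite R M] :
    ∃ D : R, IsOrder M D := by
  obtain ⟨p, n, A, hA⟩ := exists_isPresentationMatrix R M
  let _ : StrongNormalizationMonoid R := UniqueFactorizationMonoid.strongNormalizationMonoid
  let _ : NormalizedGCDMonoid R := UniqueFactorizationMonoid.toNormalizedGCDMonoid R
  exact ⟨Finset.univ.gcd fun e : Fin n → Fin p => (A.submatrix e id).det, p, n, A, hA,
    fun d => by simp [Finset.dvd_gcd_iff]⟩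

instance LaurentPolynomial.isNoetherianRing (R : Type*) [CommRing R] [IsNoetherianRing R] :
    IsNoetherianRing R[T;T⁻¹] :=
  IsLocalization.isNoetherianRing (Submonoid.powers (Polynomial.X : Polynomial R)) _ inferInstance

instance LaurentPolynomial.uniqueFactorizationMonoid (R : Type*) [CommRing R] [IsDomain R]
    [UniqueFactorizationMonoid R] : UniqueFactorizationMonoid R[T;T⁻¹] :=
  UniqueFactorizationMonoid.of_isLocalization (Submonoid.powers (Polynomial.X : Polynomial R)) _

/-! ### Generators of the twisted Alexander module -/

namespace AugmentedGroupSystem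

variable {G : Type*} [Group G] (S : AugmentedGroupSystem G) {N r n : ℕ}
  (ρ : S.K →* SymGroup N) (hρ : S.IsPeriodic ρ r)

theorem alexanderGen_mul (i : Fin N) (u v : S.K) :
    S.alexanderGen ρ r hρ i (u * v) =
      S.alexanderGen ρ r hρ i u + S.alexanderGen ρ r hρ (SymGroup.act i (ρ u)) v := by
  unfold alexanderGen
  rw [CrowellGroup.gen_mul, map_mul]
  rfl

theorem alexanderGen_one (i : Fin N) : S.alexanderGen ρ r hρ i 1 = 0 := by
  have h := S.alexanderGen_mul ρ hρ i 1 1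
  rw [mul_one, map_one] at h
  exact left_eq_add.1 h

theorem alexanderGen_inv (i : Fin N) (u : S.K) :
    S.alexanderGen ρ r hρ i u⁻¹ = -S.alexanderGen ρ r hρ (SymGroup.act i (ρ u⁻¹)) u := by
  have h := S.alexanderGen_mul ρ hρ i u⁻¹ u
  rw [inv_mul_cancel, alexanderGen_one] at h
  exact eq_neg_of_add_eq_zero_left h.symm

theorem μ_pow_apply (k : ℕ) (u : S.K) : (S.μ ^ k) u = S.μ.toMonoidHom^[k] u := by
  induction k with
  | zero => rfl
  | succ k ih =>
    rw [Function.iterate_succ_apply', pow_succ', ← ih]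
    rfl

theorem T_pow_smul_alexanderGen (i : Fin N) (u : S.K) (k : ℕ) :
    (LaurentPolynomial.T 1 : ℤ[T;T⁻¹]) ^ k • S.alexanderGen ρ r hρ i u =
      S.alexanderGen ρ r hρ i (S.μ.toMonoidHom^[r * k] u) := by
  induction k with
  | zero => simp
  | succ k ih =>
    rw [pow_succ', mul_smul, ih, T_smul_alexanderGen, mul_add, mul_one, add_comm,
      Function.iterate_add_apply]
    congr 1
    exact S.μ_pow_apply _ _

variable {S} {g : Fin n → S.K} (hg : Subgroup.closure (Set.range g) = ⊤)
include hg

/-- The elements `ⁱgⱼ` generate `K_ρ^ab` as an abelian group. -/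
theorem eq_top_of_alexanderGen_mem (H : AddSubgroup (S.AlexanderModule ρ r hρ))
    (hH : ∀ i j, S.alexanderGen ρ r hρ i (g j) ∈ H) : H = ⊤ := by
  -- The index `i` is quantified inside the induction on `u`, since products and inverses move it.
  have hmem : ∀ (u : S.K) (i : Fin N), S.alexanderGen ρ r hρ i u ∈ H := by
    intro u
    have hu : u ∈ Subgroup.closure (Set.range g) := hg ▸ Subgroup.mem_top u
    induction hu using Subgroup.closure_induction with
    | mem _ h =>
      obtain ⟨j, rfl⟩ := h
      exact fun i => hH i j
    | one =>
      intro i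
      rw [alexanderGen_one]
      exact H.zero_mem
    | mul u v _ _ hu hv =>
      intro i
      rw [alexanderGen_mul]
      exact H.add_mem (hu _) (hv _)
    | inv u _ hu =>
      intro i
      rw [alexanderGen_inv]
      exact H.neg_mem (hu _)
  let q : CrowellGroup ρ →* Abelianization (CrowellGroup ρ) := Abelianization.of
  let H' : Subgroup (Abelianization (CrowellGroup ρ)) := AddSubgroup.toSubgroup' H
  have hcomap : H'.comap q = ⊤ := by
    rw [eq_top_iff, ← PresentedGroup.closure_range_of, Subgroup.closure_le]
    rintro _ ⟨⟨i, u⟩, rfl⟩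
    exact hmem u i
  rw [eq_top_iff]
  intro m _
  obtain ⟨c, hc⟩ := QuotientGroup.mk_surjective (Additive.toMul m)
  have hc' : c ∈ H'.comap q := hcomap ▸ Subgroup.mem_top c
  have : q c ∈ H' := hc'
  rw [show q c = Additive.toMul m from hc] at this
  exact this

theorem finite_alexanderModule : Module.Finite ℤ[T;T⁻¹] (S.AlexanderModule ρ r hρ) := by
  let s : Set (S.AlexanderModule ρ r hρ) :=
    Set.range fun p : Fin N × Fin n => S.alexanderGen ρ r hρ p.1 (g p.2)
  refine ⟨Submodule.fg_def.2 ⟨s, Set.finite_range _, ?_⟩⟩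
  rw [← Submodule.toAddSubgroup_inj]
  exact eq_top_of_alexanderGen_mem ρ hρ hg _ fun i j => Submodule.subset_span ⟨(i, j), rfl⟩

/-- An additive functional on `K_ρ^ab` grows at most linearly in the word length. -/
theorem norm_alexanderGen_le (φ : S.AlexanderModule ρ r hρ →+ ℂ) (i : Fin N) (u : S.K) :
    ‖φ (S.alexanderGen ρ r hρ i u)‖ ≤
      (∑ p : Fin N × Fin n, ‖φ (S.alexanderGen ρ r hρ p.1 (g p.2))‖) * wordLength g u := by
  set C := ∑ p : Fin N × Fin n, ‖φ (S.alexanderGen ρ r hρ p.1 (g p.2))‖ with hC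
  have hle : ∀ i j, ‖φ (S.alexanderGen ρ r hρ i (g j))‖ ≤ C := fun i j =>
    Finset.single_le_sum
      (f := fun p : Fin N × Fin n => ‖φ (S.alexanderGen ρ r hρ p.1 (g p.2))‖)
      (fun _ _ => norm_nonneg _) (Finset.mem_univ (i, j))
  obtain ⟨w, hw, hwu⟩ := exists_word g hg u
  rw [← hw, ← hwu]
  clear hw hwu
  induction w generalizing i with
  | nil => simp [alexanderGen_one]
  | cons p w ih =>
    rw [List.map_cons, List.prod_cons, alexanderGen_mul, map_add, List.length_cons,
      Nat.cast_add, Nat.cast_one, mul_add, mul_one, add_comm (C * _)]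
    refine (norm_add_le _ _).trans (add_le_add ?_ (ih _))
    -- An inverse letter changes the sign and the index; `C` sums over all indices, so it bounds
    -- this term too.
    split_ifs
    · exact hle _ _
    · rw [alexanderGen_inv, map_neg, norm_neg]
      exact hle _ _

end AugmentedGroupSystem

/-! ### Growth rates and zeros -/

/-- If `‖h^{rk}(gⱼ)‖` grows at least like `c ^ k`, then the growth rate is at least `c ^ (1/r)`. -/
theorem le_growthRate {H : Type*} [Group H] {n : ℕ} (g : Fin n → H) (h : H →* H) {r : ℕ}
    (hr : 0 < r) (j : Fin n) {a c : ℝ} (ha : 0 < a) (hc : 0 ≤ c)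
    (hw : ∀ k : ℕ, a * c ^ k ≤ wordLength g (h^[r * k] (g j))) :
    ENNReal.ofReal (c ^ (1 / (r : ℝ))) ≤ growthRate g h := by
  refine le_trans ?_ (le_iSup _ j)
  let u : ℕ → ENNReal := fun k => (wordLength g (h^[k] (g j)) : ENNReal) ^ (1 / (k : ℝ))
  let v : ℕ → ENNReal := fun k =>
    ENNReal.ofReal (a ^ (1 / ((r * k : ℕ) : ℝ)) * c ^ (1 / (r : ℝ)))
  have htop : Filter.Tendsto (fun k : ℕ => r * k) Filter.atTop Filter.atTop :=
    Filter.tendsto_id.const_mul_atTop' hr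
  have hv : Filter.Tendsto v Filter.atTop (nhds (ENNReal.ofReal (c ^ (1 / (r : ℝ))))) := by
    refine ENNReal.tendsto_ofReal ?_
    have h0 : Filter.Tendsto (fun k : ℕ => 1 / ((r * k : ℕ) : ℝ)) Filter.atTop (nhds 0) :=
      tendsto_one_div_atTop_nhds_zero_nat.comp htop
    have h1 := ((Real.continuousAt_const_rpow ha.ne').tendsto.comp h0).mul_const (c ^ (1 / (r : ℝ)))
    simpa using h1
  rw [← hv.limsup_eq]
  -- The limsup along the multiples of `r` is at most the full one, and the factor `a ^ (1 / (r *
  -- k))` tends to `1`.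
  refine le_trans (Filter.limsup_le_limsup ?_) (htop.limsup_comp_le_limsup (u := u))
  filter_upwards [Filter.eventually_gt_atTop 0] with k hk
  have hrR : (r : ℝ) ≠ 0 := by positivity
  have hkR : (k : ℝ) ≠ 0 := by positivity
  have hck : (c ^ k) ^ (1 / ((r * k : ℕ) : ℝ)) = c ^ (1 / (r : ℝ)) := by
    rw [← Real.rpow_natCast, ← Real.rpow_mul hc]
    congr 1
    push_cast
    field_simp
  change v k ≤ u (r * k)
  calc v k = ENNReal.ofReal (a * c ^ k) ^ (1 / ((r * k : ℕ) : ℝ)) := by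
        rw [ENNReal.ofReal_rpow_of_nonneg (by positivity) (by positivity),
          Real.mul_rpow ha.le (by positivity), hck]
    _ ≤ _ := by
        refine ENNReal.rpow_le_rpow ?_ (by positivity)
        rw [← ENNReal.ofReal_natCast]
        exact ENNReal.ofReal_le_ofReal (hw k)

theorem AugmentedGroupSystem.IsAlexanderLin.zero_le_growthRate {G : Type*} [Group G]
    {S : AugmentedGroupSystem G} {N r n : ℕ} (hr : 0 < r) {ρ : S.K →* SymGroup N}
    {hρ : S.IsPeriodic ρ r} {g : Fin n → S.K} (hg : Subgroup.closure (Set.range g) = ⊤)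
    {D : ℤ[T;T⁻¹]} (hD : S.IsAlexanderLin ρ r hρ D) (z : ℂˣ)
    (hz : LaurentPolynomial.eval₂ (Int.castRingHom ℂ) z D = 0) :
    ENNReal.ofReal (‖(z : ℂ)‖ ^ (1 / (r : ℝ))) ≤ growthRate g S.μ.toMonoidHom := by
  obtain ⟨φ, hφ⟩ := IsOrder.exists_semilinear hD _ hz
  obtain ⟨i, j, hij⟩ : ∃ i j, φ (S.alexanderGen ρ r hρ i (g j)) ≠ 0 := by
    by_contra! h
    refine hφ (LinearMap.ext fun m => ?_)
    have htop := eq_top_of_alexanderGen_mem ρ hρ hg φ.toAddMonoidHom.ker h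
    -- An additive map vanishing on all `ⁱgⱼ` is zero, as these generate `K_ρ^ab` as an abelian
    -- group.
    have hm : m ∈ φ.toAddMonoidHom.ker := htop ▸ AddSubgroup.mem_top m
    exact hm
  set C := ∑ p : Fin N × Fin n, ‖φ (S.alexanderGen ρ r hρ p.1 (g p.2))‖ with hC
  have hpos : 0 < ‖φ (S.alexanderGen ρ r hρ i (g j))‖ := norm_pos_iff.2 hij
  have hCpos : 0 < C := hpos.trans_le <| Finset.single_le_sum
    (f := fun p : Fin N × Fin n => ‖φ (S.alexanderGen ρ r hρ p.1 (g p.2))‖)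
    (fun _ _ => norm_nonneg _) (Finset.mem_univ (i, j))
  refine le_growthRate g S.μ.toMonoidHom hr j (div_pos hpos hCpos) (norm_nonneg _) fun k => ?_
  have hk := norm_alexanderGen_le ρ hρ hg φ.toAddMonoidHom i (S.μ.toMonoidHom^[r * k] (g j))
  rw [← T_pow_smul_alexanderGen, LinearMap.toAddMonoidHom_coe, LinearMap.map_smulₛₗ, map_pow,
    LaurentPolynomial.eval₂_T, zpow_one, smul_eq_mul, norm_mul, norm_pow] at hk
  rw [div_mul_eq_mul_div, div_le_iff₀ hCpos, mul_comm, mul_comm _ C]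
  exact hk

theorem mainTheorem3 {G : Type*} [Group G] (S : AugmentedGroupSystem G)
    {N r : ℕ} (hr : 0 < r) (ρ : S.K →* SymGroup N) (hρ : S.IsPeriodic ρ r)
    {n : ℕ} (g : Fin n → S.K) (hg : Subgroup.closure (Set.range g) = ⊤) :
    (∃ D : ℤ[T;T⁻¹], S.IsAlexanderLin ρ r hρ D) ∧
    ∀ D : ℤ[T;T⁻¹], S.IsAlexanderLin ρ r hρ D →
      D ≠ 0 ∧
      ∀ z : ℂˣ, LaurentPolynomial.eval₂ (Int.castRingHom ℂ) z D = 0 →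
        ENNReal.ofReal (‖(z : ℂ)‖ ^ (1 / (r : ℝ))) ≤ growthRate g S.μ.toMonoidHom := by
  have := AugmentedGroupSystem.finite_alexanderModule ρ hρ hg
  refine ⟨exists_isOrder _ _, fun D hD => ⟨?_, hD.zero_le_growthRate hr hg⟩⟩
  rintro rfl
  have hle := fun z : ℂˣ => hD.zero_le_growthRate hr hg z (map_zero _)
  obtain ⟨m, hm⟩ := ENNReal.exists_nat_gt
    (growthRate_lt_top g hg S.μ.toMonoidHom).ne
  -- With `m` above the growth rate, the point `z = (m + 1) ^ r` has `|z| ^ (1 / r) = m + 1 > m`.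
  have hz : (((m + 1) ^ r : ℕ) : ℂ) ≠ 0 := by exact_mod_cast (by positivity)
  have h := hle (Units.mk0 _ hz)
  rw [Units.val_mk0, Complex.norm_natCast, Nat.cast_pow, one_div,
    Real.pow_rpow_inv_natCast (by positivity) hr.ne', ENNReal.ofReal_natCast] at h
  have : (((m + 1 : ℕ) : ENNReal)) < m := h.trans_lt hm
  rw [Nat.cast_lt] at this
  omega
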